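/- \textbf{Theorem.} Over the base theory $\mathbf{RCA}_0$ of second-order arithmetic (the basic axioms for $0,1,+,\cdot,<$, together with $\Sigma^0_1$-induction and $\Delta^0_1$-comprehension, both with number and set parameters), the principle of $\Sigma^0_2$-induction is implied by the following restriction of Fra\"iss\'e's conjecture: ($\mathcal{WF}1$) For any infinite sequence of well orders $L_0,L_1,\ldots$ such that each $L_{n+1}$ embeds into $L_n$, there are $i<j$ such that $L_i$ embeds into $L_j$. In other words, every model of $\mathbf{RCA}_0$ (with an arbitrary, possibly nonstandard first-order part and an arbitrary collection of subsets of it as second-order part) in which $(\mathcal{WF}1)$ holds satisfies, for every $\Sigma^0_2$-formula $\psi(x)\equiv\exists u\,\forall v\,\phi(x,u,v)$ (with $\phi$ a bounded formula, with number and set parameters from the model), the induction axiom $$\psi(0)\land\forall x\,\bigl(\psi(x)\to\psi(x+1)\bigr)\to\forall x\,\psi(x).$$ By G\"odel's completeness theorem this is the same as saying that $\mathbf{RCA}_0+(\mathcal{WF}1)$ proves each instance of $\Sigma^0_2$-induction. Here all notions are understood in the sense of second-order arithmetic. A linear order is coded by the set of pairs $(x,y)$ of numbers with $x\le y$ in the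 order; it is a well order if there is no function that is an infinite strictly descending sequence in it; an embedding is a function $f$ between the orders with $x\le x'$ if and only if $f(x)\le f(x')$; a sequence $L_0,L_1,\ldots$ is given by a single set $L$ with $L_n=\{x\mid (x,n)\in L\}$. The embeddings of $L_{n+1}$ into $L_n$ are only assumed to exist for each $n$ separately, not as a uniform sequence. -/

import Mathlib

universe u

/-- A structure for the language of second-order arithmetic: a set `N` of numbers with `0`, `1`,
`+`, `·` and `<`, together with a collection `sets` of subsets of `N`, over which the set variables
range (Henkin semantics; the first-order part may be nonstandard). -/
structure L2Structure : Type (u + 1) where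
  N : Type u
  [instZero : Zero N]
  [instOne : One N]
  [instAdd : Add N]
  [instMul : Mul N]
  [instLT : LT N]
  sets : Set (Set N)

attribute [instance] L2Structure.instZero L2Structure.instOne L2Structure.instAdd
  L2Structure.instMul L2Structure.instLT

namespace L2Structure

/-- Number terms with parameters from `M` and free variables `0, …, n - 1`. -/
inductive Term (M : L2Structure.{u}) (n : ℕ) : Type u
  | var (i : Fin n) : Term M n
  | param (a : M.N) : Term M n
  | zero : Term M n
  | one : Term M n
  | add (s t : Term M n) : Term M n
  | mul (s t : Term M n) : Term M n

/-- The value of a term under an assignment of its free variables. -/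
def Term.val {M : L2Structure.{u}} {n : ℕ} (v : Fin n → M.N) : Term M n → M.N
  | .var i => v i
  | .param a => a
  | .zero => 0
  | .one => 1
  | .add s t => s.val v + t.val v
  | .mul s t => s.val v * t.val v

/-- Arithmetical formulas (no set quantifiers) with number parameters and set parameters from `M`
and with free number variables `0, …, n - 1`. Each quantifier binds the variable `0` of its scope
and shifts the others by one. The bound `t` of a bounded quantifier cannot contain the variable that
is bound. A statement about all formulas with parameters from `M` amounts to the truth in `M` of
the universal closures of the corresponding statements about formulas with free variables. -/
inductive Formula (M : L2Structure.{u}) : ℕ → Type u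
  | eq {n : ℕ} (s t : Term M n) : Formula M n
  | lt {n : ℕ} (s t : Term M n) : Formula M n
  | mem {n : ℕ} (t : Term M n) (X : M.sets) : Formula M n
  | neg {n : ℕ} (φ : Formula M n) : Formula M n
  | and {n : ℕ} (φ ψ : Formula M n) : Formula M n
  | or {n : ℕ} (φ ψ : Formula M n) : Formula M n
  | imp {n : ℕ} (φ ψ : Formula M n) : Formula M n
  | allLT {n : ℕ} (t : Term M n) (φ : Formula M (n + 1)) : Formula M n
  | exLT {n : ℕ} (t : Term M n) (φ : Formula M (n + 1)) : Formula M n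
  | all {n : ℕ} (φ : Formula M (n + 1)) : Formula M n
  | ex {n : ℕ} (φ : Formula M (n + 1)) : Formula M n

namespace Formula

variable {M : L2Structure.{u}}

/-- Truth of a formula in `M` under an assignment of its free variables. -/
def Realize : {n : ℕ} → Formula M n → (Fin n → M.N) → Prop
  | _, .eq s t, v => s.val v = t.val v
  | _, .lt s t, v => s.val v < t.val v
  | _, .mem t X, v => t.val v ∈ (X : Set M.N)
  | _, .neg φ, v => ¬ φ.Realize v
  | _, .and φ ψ, v => φ.Realize v ∧ ψ.Realize v
  | _, .or φ ψ, v => φ.Realize v ∨ ψ.Realize v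
  | _, .imp φ ψ, v => φ.Realize v → ψ.Realize v
  | _, .allLT t φ, v => ∀ x : M.N, x < t.val v → φ.Realize (Fin.cons x v)
  | _, .exLT t φ, v => ∃ x : M.N, x < t.val v ∧ φ.Realize (Fin.cons x v)
  | _, .all φ, v => ∀ x : M.N, φ.Realize (Fin.cons x v)
  | _, .ex φ, v => ∃ x : M.N, φ.Realize (Fin.cons x v)

/-- Bounded formulas, i.e. `Σ⁰₀` formulas: all quantifiers are bounded. -/
def IsBounded : {n : ℕ} → Formula M n → Prop
  | _, .eq _ _ => True
  | _, .lt _ _ => True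
  | _, .mem _ _ => True
  | _, .neg φ => φ.IsBounded
  | _, .and φ ψ => φ.IsBounded ∧ ψ.IsBounded
  | _, .or φ ψ => φ.IsBounded ∧ ψ.IsBounded
  | _, .imp φ ψ => φ.IsBounded ∧ ψ.IsBounded
  | _, .allLT _ φ => φ.IsBounded
  | _, .exLT _ φ => φ.IsBounded
  | _, .all _ => False
  | _, .ex _ => False

/-- `Σ⁰₁` formulas: `∃ u, θ` with `θ` bounded. -/
def IsSigma01 {n : ℕ} (φ : Formula M n) : Prop :=
  ∃ θ : Formula M (n + 1), θ.IsBounded ∧ φ = .ex θ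

/-- `Π⁰₁` formulas: `∀ u, θ` with `θ` bounded. -/
def IsPi01 {n : ℕ} (φ : Formula M n) : Prop :=
  ∃ θ : Formula M (n + 1), θ.IsBounded ∧ φ = .all θ

/-- `Σ⁰₂` formulas: `∃ u, ∀ v, θ` with `θ` bounded. -/
def IsSigma02 {n : ℕ} (φ : Formula M n) : Prop :=
  ∃ θ : Formula M (n + 1), θ.IsPi01 ∧ φ = .ex θ

/-- Truth of a formula `φ(x)` with one free variable at the number `x`. -/
def Holds (φ : Formula M 1) (x : M.N) : Prop :=
  φ.Realize ![x]

/-- The induction axiom for `φ(x)`. -/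
def Induction (φ : Formula M 1) : Prop :=
  φ.Holds 0 → (∀ x : M.N, φ.Holds x → φ.Holds (x + 1)) → ∀ x : M.N, φ.Holds x

end Formula

/-- `M` is a model of `RCA₀`: basic axioms of arithmetic, `Σ⁰₁`-induction and
`Δ⁰₁`-comprehension (the latter two with arbitrary number and set parameters). -/
structure IsModelRCA0 (M : L2Structure.{u}) : Prop where
  add_one_ne_zero : ∀ m : M.N, m + 1 ≠ 0
  add_one_inj : ∀ m n : M.N, m + 1 = n + 1 → m = n
  add_zero : ∀ m : M.N, m + 0 = m
  add_add_one : ∀ m n : M.N, m + (n + 1) = (m + n) + 1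
  mul_zero : ∀ m : M.N, m * 0 = 0
  mul_add_one : ∀ m n : M.N, m * (n + 1) = m * n + m
  not_lt_zero : ∀ m : M.N, ¬ m < 0
  lt_add_one_iff : ∀ m n : M.N, m < n + 1 ↔ m < n ∨ m = n
  sigma01_induction : ∀ φ : Formula M 1, φ.IsSigma01 → φ.Induction
  delta01_comprehension : ∀ φ ψ : Formula M 1, φ.IsSigma01 → ψ.IsPi01 →
    (∀ x : M.N, φ.Holds x ↔ ψ.Holds x) → ∃ X ∈ M.sets, ∀ x : M.N, x ∈ X ↔ φ.Holds x

/-- The principle of `Σ⁰₂`-induction holds in `M`. -/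
def Sigma02Induction (M : L2Structure.{u}) : Prop :=
  ∀ φ : Formula M 1, φ.IsSigma02 → φ.Induction

variable (M : L2Structure.{u})

/-- The usual code `(x + y)² + x` of the pair `(x, y)` in second-order arithmetic. -/
def pair (x y : M.N) : M.N :=
  (x + y) * (x + y) + x

/-- The `n`-th member `(L)ₙ` of the sequence of sets that is coded by `L`. -/
def nth (L : Set M.N) (n : M.N) : Set M.N :=
  {x | M.pair x n ∈ L}

/-- `F` codes a function from `D` to `E`, as a set of pairs. -/
def IsFunction (F D E : Set M.N) : Prop :=
  (∀ p ∈ F, ∃ x ∈ D, ∃ y ∈ E, p = M.pair x y) ∧ ∀ x ∈ D, ∃! y, M.pair x y ∈ F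

/-- The field of a reflexive relation `X`, which is given as a set of pairs. -/
def field (X : Set M.N) : Set M.N :=
  {x | M.pair x x ∈ X}

/-- `X` codes a linear order (the set of all pairs `(x, y)` with `x ≤ y` in the order). -/
def IsLinOrd (X : Set M.N) : Prop :=
  (∀ p ∈ X, ∃ x ∈ M.field X, ∃ y ∈ M.field X, p = M.pair x y) ∧
  (∀ x y z : M.N, M.pair x y ∈ X → M.pair y z ∈ X → M.pair x z ∈ X) ∧
  (∀ x y : M.N, M.pair x y ∈ X → M.pair y x ∈ X → x = y) ∧
  (∀ x ∈ M.field X, ∀ y ∈ M.field X, M.pair x y ∈ X ∨ M.pair y x ∈ X)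

/-- `X` is a well order in the sense of `M`: a linear order in which no function `F` of the model
is an infinite strictly descending sequence. -/
def IsWellOrd (X : Set M.N) : Prop :=
  M.IsLinOrd X ∧
  ¬ ∃ F ∈ M.sets, M.IsFunction F Set.univ (M.field X) ∧
    ∀ n a b : M.N, M.pair n a ∈ F → M.pair (n + 1) b ∈ F → M.pair b a ∈ X ∧ b ≠ a

/-- Some function `F` of the model is an order embedding of `X` into `Y`. -/
def Embeds (X Y : Set M.N) : Prop :=
  ∃ F ∈ M.sets, M.IsFunction F (M.field X) (M.field Y) ∧
    ∀ x x' y y' : M.N, M.pair x y ∈ F → M.pair x' y' ∈ F →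
      (M.pair x x' ∈ X ↔ M.pair y y' ∈ Y)

/-- Fraïssé's conjecture for descending sequences of well orders, as a statement about `M`: for any
sequence `L₀, L₁, …` of well orders such that each `Lₙ₊₁` embeds into `Lₙ`, there are `i < j` such
that `Lᵢ` embeds into `Lⱼ`. -/
def WF1 : Prop :=
  ∀ L ∈ M.sets, (∀ n : M.N, M.IsWellOrd (M.nth L n)) →
    (∀ n : M.N, M.Embeds (M.nth L (n + 1)) (M.nth L n)) →
    ∃ i j : M.N, i < j ∧ M.Embeds (M.nth L i) (M.nth L j)

end L2Structure

/-! Write ψ(x) for `∃ u, ∀ v, R x u v`, and suppose that ψ(0) holds and ψ is inductive while ψ(a)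
fails. Let `B` hold of (x, i, s) when x ≤ a and every u ≤ i has some v < s refuting `R x u v`. The
component s keeps `B` bounded, so that comprehension applies. Order the triples lexicographically,
with x descending and i, s ascending, and let L_k be the part with i ≥ k. Since x ≤ a, every
nonempty Σ⁰₁ class of such triples has a least element (`exists_key_le`), so each L_k is a well
order; L_{k+1} embeds into L_k by inclusion.

By WF1 some f embeds L_k into L_m with k < m. Lowering i by one maps L_m into L_k and preserves the
order. So f followed by this shift embeds L_k into itself and cannot lower any element: f(z) is at
least z moved up by one row, a row being given by (x, i) (`exists_key_shift_le`). Hence L_k has no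
last row (`not_embeds_nth_tailSeq`).

But L_k does have a last row. Take the least x for which no u ≤ k witnesses ψ(x); a is a candidate.
Either x = 0 or the predecessor of x satisfies ψ, so ψ(x) holds. A witness of ψ(x) bounds the i that
occur with x, and there is a greatest one (`WF1.sigma02`). -/

namespace L2Structure

variable {M : L2Structure.{u}} {n : ℕ}

/-! ### Substitution in terms and formulas -/

/-- Substitution of terms for the variables of a term. -/
def Term.subst {m : ℕ} (σ : Fin n → Term M m) : Term M n → Term M m
  | .var i => σ i
  | .param a => .param a
  | .zero => .zero
  | .one => .one
  | .add s t => .add (s.subst σ) (t.subst σ)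
  | .mul s t => .mul (s.subst σ) (t.subst σ)

theorem Term.val_subst {m : ℕ} (σ : Fin n → Term M m) (v : Fin m → M.N) (t : Term M n) :
    (t.subst σ).val v = t.val fun i => (σ i).val v := by
  induction t <;> simp_all [Term.subst, Term.val]

/-- The extension of a substitution to the scope of a quantifier. -/
def Term.lift {m : ℕ} (σ : Fin n → Term M m) : Fin (n + 1) → Term M (m + 1) :=
  Fin.cons (.var 0) fun i => (σ i).subst fun j => .var j.succ

theorem Term.val_lift {m : ℕ} (σ : Fin n → Term M m) (v : Fin m → M.N) (x : M.N) :
    (fun i => (Term.lift σ i).val (Fin.cons x v)) = Fin.cons x fun i => (σ i).val v := by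
  funext i
  refine Fin.cases ?_ (fun j => ?_) i
  · simp [Term.lift, Term.val]
  · simp [Term.lift, Term.val_subst, Term.val]

/-- Substitution of terms for the free variables of a formula. -/
def Formula.subst : {n : ℕ} → Formula M n → {m : ℕ} → (Fin n → Term M m) → Formula M m
  | _, .eq s t, _, σ => .eq (s.subst σ) (t.subst σ)
  | _, .lt s t, _, σ => .lt (s.subst σ) (t.subst σ)
  | _, .mem t X, _, σ => .mem (t.subst σ) X
  | _, .neg φ, _, σ => .neg (φ.subst σ)
  | _, .and φ ψ, _, σ => .and (φ.subst σ) (ψ.subst σ)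
  | _, .or φ ψ, _, σ => .or (φ.subst σ) (ψ.subst σ)
  | _, .imp φ ψ, _, σ => .imp (φ.subst σ) (ψ.subst σ)
  | _, .allLT t φ, _, σ => .allLT (t.subst σ) (φ.subst (Term.lift σ))
  | _, .exLT t φ, _, σ => .exLT (t.subst σ) (φ.subst (Term.lift σ))
  | _, .all φ, _, σ => .all (φ.subst (Term.lift σ))
  | _, .ex φ, _, σ => .ex (φ.subst (Term.lift σ))

theorem Formula.realize_subst (φ : Formula M n) {m : ℕ} (σ : Fin n → Term M m)
    (v : Fin m → M.N) : (φ.subst σ).Realize v ↔ φ.Realize fun i => (σ i).val v := by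
  induction φ generalizing m <;>
    simp_all [Formula.subst, Formula.Realize, Term.val_subst, Term.val_lift]

theorem Formula.isBounded_subst (φ : Formula M n) {m : ℕ} (σ : Fin n → Term M m)
    (h : φ.IsBounded) : (φ.subst σ).IsBounded := by
  induction φ generalizing m <;> simp_all [Formula.subst, Formula.IsBounded]

/-! ### Bounded definability, checked by instance search -/

/-- `f` is the value of a term. -/
class IsTerm (f : (Fin n → M.N) → M.N) : Prop where
  exists_term : ∃ t : Term M n, ∀ v, t.val v = f v

namespace IsTerm

variable {f g : (Fin n → M.N) → M.N}

instance var (i : Fin n) : IsTerm (fun v : Fin n → M.N => v i) :=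
  ⟨.var i, fun _ => rfl⟩

instance param (a : M.N) : IsTerm (fun _ : Fin n → M.N => a) :=
  ⟨.param a, fun _ => rfl⟩

instance add [hf : IsTerm f] [hg : IsTerm g] : IsTerm (fun v => f v + g v) := by
  obtain ⟨s, hs⟩ := hf
  obtain ⟨t, ht⟩ := hg
  exact ⟨.add s t, fun v => by simp [Term.val, hs, ht]⟩

instance mul [hf : IsTerm f] [hg : IsTerm g] : IsTerm (fun v => f v * g v) := by
  obtain ⟨s, hs⟩ := hf
  obtain ⟨t, ht⟩ := hg
  exact ⟨.mul s t, fun v => by simp [Term.val, hs, ht]⟩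

instance pair [IsTerm f] [IsTerm g] : IsTerm (fun v => M.pair (f v) (g v)) := by
  unfold L2Structure.pair
  infer_instance

end IsTerm

/-- `P` is definable by a bounded formula with parameters. -/
class Bdd (P : (Fin n → M.N) → Prop) : Prop where
  exists_formula : ∃ φ : Formula M n, φ.IsBounded ∧ ∀ v, φ.Realize v ↔ P v

namespace Bdd

variable {P Q : (Fin n → M.N) → Prop} {f g : (Fin n → M.N) → M.N}

theorem congr [hP : Bdd P] (h : ∀ v, P v ↔ Q v) : Bdd Q := by
  obtain ⟨φ, hφ, h'⟩ := hP
  exact ⟨φ, hφ, fun v => (h' v).trans (h v)⟩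

instance eq [hf : IsTerm f] [hg : IsTerm g] : Bdd (fun v => f v = g v) := by
  obtain ⟨s, hs⟩ := hf
  obtain ⟨t, ht⟩ := hg
  exact ⟨.eq s t, trivial, fun v => by simp [Formula.Realize, hs, ht]⟩

instance lt [hf : IsTerm f] [hg : IsTerm g] : Bdd (fun v => f v < g v) := by
  obtain ⟨s, hs⟩ := hf
  obtain ⟨t, ht⟩ := hg
  exact ⟨.lt s t, trivial, fun v => by simp [Formula.Realize, hs, ht]⟩

theorem mem [hf : IsTerm f] {X : Set M.N} (hX : X ∈ M.sets) : Bdd (fun v => f v ∈ X) := by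
  obtain ⟨s, hs⟩ := hf
  exact ⟨.mem s ⟨X, hX⟩, trivial, fun v => by simp [Formula.Realize, hs]⟩

instance not [hP : Bdd P] : Bdd (fun v => ¬ P v) := by
  obtain ⟨φ, hφ, h⟩ := hP
  exact ⟨.neg φ, hφ, fun v => by simp [Formula.Realize, h]⟩

instance and [hP : Bdd P] [hQ : Bdd Q] : Bdd (fun v => P v ∧ Q v) := by
  obtain ⟨φ, hφ, h⟩ := hP
  obtain ⟨ψ, hψ, h'⟩ := hQ
  exact ⟨.and φ ψ, ⟨hφ, hψ⟩, fun v => by simp [Formula.Realize, h, h']⟩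

instance or [hP : Bdd P] [hQ : Bdd Q] : Bdd (fun v => P v ∨ Q v) := by
  obtain ⟨φ, hφ, h⟩ := hP
  obtain ⟨ψ, hψ, h'⟩ := hQ
  exact ⟨.or φ ψ, ⟨hφ, hψ⟩, fun v => by simp [Formula.Realize, h, h']⟩

instance imp [hP : Bdd P] [hQ : Bdd Q] : Bdd (fun v => P v → Q v) := by
  obtain ⟨φ, hφ, h⟩ := hP
  obtain ⟨ψ, hψ, h'⟩ := hQ
  exact ⟨.imp φ ψ, ⟨hφ, hψ⟩, fun v => by simp [Formula.Realize, h, h']⟩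

instance allLT {P : (Fin n → M.N) → M.N → Prop} [hf : IsTerm f]
    [hP : Bdd (fun w : Fin (n + 1) → M.N => P (fun i => w i.succ) (w 0))] :
    Bdd (fun v => ∀ x, x < f v → P v x) := by
  obtain ⟨s, hs⟩ := hf
  obtain ⟨φ, hφ, h⟩ := hP
  exact ⟨.allLT s φ, hφ, fun v => by simp [Formula.Realize, h, hs]⟩

instance exLT {P : (Fin n → M.N) → M.N → Prop} [hf : IsTerm f]
    [hP : Bdd (fun w : Fin (n + 1) → M.N => P (fun i => w i.succ) (w 0))] :
    Bdd (fun v => ∃ x, x < f v ∧ P v x) := by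
  obtain ⟨s, hs⟩ := hf
  obtain ⟨φ, hφ, h⟩ := hP
  exact ⟨.exLT s φ, hφ, fun v => by simp [Formula.Realize, h, hs]⟩

theorem subst {m : ℕ} {σ : (Fin m → M.N) → Fin n → M.N} [hP : Bdd P]
    (hσ : ∀ i, IsTerm fun v => σ v i) : Bdd (fun v => P (σ v)) := by
  obtain ⟨φ, hφ, h⟩ := hP
  choose t ht using fun i => (hσ i).exists_term
  refine ⟨φ.subst t, φ.isBounded_subst t hφ, fun v => ?_⟩
  rw [φ.realize_subst, h]
  simp [ht]

end Bdd

/-! ### The ordered semiring of numbers, from bounded induction -/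

section Arithmetic

variable [hM : Fact M.IsModelRCA0]

/-- A vacuous existential quantifier turns the bounded formula into a Σ⁰₁ one. -/
theorem bdd_induction {P : M.N → Prop} (hP : Bdd fun v : Fin 1 → M.N => P (v 0)) (h0 : P 0)
    (h1 : ∀ x, P x → P (x + 1)) (x : M.N) : P x := by
  have : Bdd (fun w : Fin 2 → M.N => P (w 1)) :=
    Bdd.subst (P := fun v : Fin 1 → M.N => P (v 0)) (σ := fun w _ => w 1) fun _ => inferInstance
  obtain ⟨φ, hφ, h⟩ := this
  have key : ∀ y, (Formula.ex φ).Holds y ↔ P y := fun y => by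
    simp [Formula.Holds, Formula.Realize, h]
  exact (key x).1 (hM.out.sigma01_induction (.ex φ) ⟨φ, hφ, rfl⟩ ((key 0).2 h0)
    (fun y hy => (key _).2 (h1 y ((key y).1 hy))) x)

namespace N

protected theorem add_zero (a : M.N) : a + 0 = a := hM.out.add_zero a

protected theorem add_succ (a b : M.N) : a + (b + 1) = a + b + 1 := hM.out.add_add_one a b

protected theorem mul_zero (a : M.N) : a * 0 = 0 := hM.out.mul_zero a

protected theorem mul_succ (a b : M.N) : a * (b + 1) = a * b + a := hM.out.mul_add_one a b

protected theorem add_assoc (a b c : M.N) : a + b + c = a + (b + c) := by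
  refine bdd_induction (P := fun c => a + b + c = a + (b + c)) inferInstance ?_ (fun c h => ?_) c
  · simp only [N.add_zero]
  · simp only [N.add_succ, h]

protected theorem zero_add (a : M.N) : 0 + a = a := by
  refine bdd_induction (P := fun a => 0 + a = a) inferInstance ?_ (fun c h => ?_) a
  · simp only [N.add_zero]
  · simp only [N.add_succ, h]

protected theorem succ_add (a b : M.N) : a + 1 + b = a + b + 1 := by
  refine bdd_induction (P := fun b => a + 1 + b = a + b + 1) inferInstance ?_ (fun c h => ?_) b
  · simp only [N.add_zero]
  · simp only [N.add_succ, h]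

protected theorem add_comm (a b : M.N) : a + b = b + a := by
  refine bdd_induction (P := fun b => a + b = b + a) inferInstance ?_ (fun c h => ?_) b
  · simp only [N.add_zero, N.zero_add]
  · simp only [N.add_succ, N.succ_add, h]

protected theorem mul_add (a b c : M.N) : a * (b + c) = a * b + a * c := by
  refine bdd_induction (P := fun c => a * (b + c) = a * b + a * c) inferInstance ?_
    (fun c h => ?_) c
  · simp only [N.add_zero, N.mul_zero]
  · rw [N.add_succ, N.mul_succ, h, N.mul_succ, N.add_assoc]

protected theorem mul_assoc (a b c : M.N) : a * b * c = a * (b * c) := by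
  refine bdd_induction (P := fun c => a * b * c = a * (b * c)) inferInstance ?_ (fun c h => ?_) c
  · simp only [N.mul_zero]
  · rw [N.mul_succ, h, N.mul_succ, N.mul_add]

protected theorem zero_mul (a : M.N) : 0 * a = 0 := by
  refine bdd_induction (P := fun a => 0 * a = 0) inferInstance ?_ (fun c h => ?_) a
  · simp only [N.mul_zero]
  · simp only [N.mul_succ, h, N.add_zero]

protected theorem succ_mul (a b : M.N) : (a + 1) * b = a * b + b := by
  refine bdd_induction (P := fun b => (a + 1) * b = a * b + b) inferInstance ?_ (fun c h => ?_) b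
  · simp only [N.mul_zero, N.add_zero]
  · rw [N.mul_succ, N.mul_succ, h, N.add_assoc, N.add_assoc (a * c), N.add_succ c, N.add_succ a,
      N.add_comm c]

protected theorem mul_comm (a b : M.N) : a * b = b * a := by
  refine bdd_induction (P := fun b => a * b = b * a) inferInstance ?_ (fun c h => ?_) b
  · simp only [N.mul_zero, N.zero_mul]
  · simp only [N.mul_succ, N.succ_mul, h]

protected theorem mul_one (a : M.N) : a * 1 = a := by
  rw [← N.zero_add 1, N.mul_succ, N.mul_zero, N.zero_add]

/-- The numbers of a model of `RCA₀` form a commutative semiring. -/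
noncomputable instance : CommSemiring M.N where
  add_assoc := N.add_assoc
  zero_add := N.zero_add
  add_zero := N.add_zero
  add_comm := N.add_comm
  left_distrib := N.mul_add
  right_distrib a b c := by rw [N.mul_comm, N.mul_add, N.mul_comm c a, N.mul_comm c b]
  zero_mul := N.zero_mul
  mul_zero := N.mul_zero
  mul_assoc := N.mul_assoc
  one_mul a := by rw [N.mul_comm, N.mul_one]
  mul_one := N.mul_one
  mul_comm := N.mul_comm
  nsmul := nsmulRec

protected theorem lt_succ_iff {a b : M.N} : a < b + 1 ↔ a < b ∨ a = b :=
  hM.out.lt_add_one_iff a b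

protected theorem not_lt_zero (a : M.N) : ¬ a < 0 := hM.out.not_lt_zero a

protected theorem lt_succ (a : M.N) : a < a + 1 := N.lt_succ_iff.2 (.inr rfl)

protected theorem lt_trans {a b c : M.N} (hab : a < b) (hbc : b < c) : a < c := by
  refine bdd_induction (P := fun c => b < c → a < c) inferInstance
    (fun h => (N.not_lt_zero _ h).elim) (fun c h hb => ?_) c hbc
  rcases N.lt_succ_iff.1 hb with hb | rfl
  · exact N.lt_succ_iff.2 (.inl (h hb))
  · exact N.lt_succ_iff.2 (.inl hab)

protected theorem lt_irrefl (a : M.N) : ¬ a < a := by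
  refine bdd_induction (P := fun a => ¬ a < a) inferInstance (N.not_lt_zero _)
    (fun a h ha => h ?_) a
  rcases N.lt_succ_iff.1 ha with h' | h'
  · exact N.lt_trans (N.lt_succ a) h'
  · have := N.lt_succ a
    rwa [h'] at this

protected theorem succ_le {a b : M.N} (h : a < b) : a + 1 < b ∨ a + 1 = b := by
  refine bdd_induction (P := fun b => a < b → a + 1 < b ∨ a + 1 = b) inferInstance
    (fun h => (N.not_lt_zero _ h).elim) (fun b ih hb => ?_) b h
  rcases N.lt_succ_iff.1 hb with hb | rfl
  · exact .inl (N.lt_succ_iff.2 (ih hb))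
  · exact .inr rfl

protected theorem zero_lt_or (a : M.N) : 0 < a ∨ 0 = a := by
  refine bdd_induction (P := fun a => 0 < a ∨ 0 = a) inferInstance (.inr rfl) (fun a h => ?_) a
  exact .inl (N.lt_succ_iff.2 h)

protected theorem lt_trichotomy (a b : M.N) : a < b ∨ a = b ∨ b < a := by
  refine bdd_induction (P := fun b => a < b ∨ a = b ∨ b < a) inferInstance ?_ (fun b h => ?_) b
  · rcases N.zero_lt_or a with h | h
    exacts [.inr (.inr h), .inr (.inl h.symm)]
  · rcases h with h | h | h
    · exact .inl (N.lt_succ_iff.2 (.inl h))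
    · exact .inl (N.lt_succ_iff.2 (.inr h))
    · rcases N.succ_le h with h | h
      exacts [.inr (.inr h), .inr (.inl h.symm)]

/-- The numbers of a model of `RCA₀` are linearly ordered. -/
noncomputable instance : LinearOrder M.N where
  le a b := a < b ∨ a = b
  le_refl _ := .inr rfl
  le_trans a b c := by
    rintro (h | rfl) (h' | rfl)
    exacts [.inl (N.lt_trans h h'), .inl h, .inl h', .inr rfl]
  le_antisymm a b := by
    rintro (h | rfl) (h' | h')
    exacts [(N.lt_irrefl _ (N.lt_trans h h')).elim, h'.symm, rfl, rfl]
  le_total a b := by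
    rcases N.lt_trichotomy a b with h | h | h
    exacts [.inl (.inl h), .inl (.inr h), .inr (.inl h)]
  lt_iff_le_not_ge a b := by
    refine ⟨fun h => ⟨.inl h, ?_⟩, ?_⟩
    · rintro (h' | rfl)
      exacts [N.lt_irrefl _ (N.lt_trans h h'), N.lt_irrefl _ h]
    · rintro ⟨h | rfl, h'⟩
      exacts [h, (h' (.inr rfl)).elim]
  toDecidableLE := Classical.decRel _

theorem lt_add_one_iff {a b : M.N} : a < b + 1 ↔ a ≤ b := N.lt_succ_iff

theorem add_one_le_iff {a b : M.N} : a + 1 ≤ b ↔ a < b :=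
  ⟨fun h => (N.lt_succ a).trans_le h, N.succ_le⟩

protected theorem zero_le (a : M.N) : 0 ≤ a := N.zero_lt_or a

protected theorem add_lt_add {a b : M.N} (h : a < b) (c : M.N) : a + c < b + c := by
  refine bdd_induction (P := fun c => a + c < b + c) inferInstance ?_ (fun c h => ?_) c
  · simpa using h
  · rw [N.add_succ, N.add_succ, lt_add_one_iff, add_one_le_iff]
    exact h

protected theorem mul_lt_mul {a b : M.N} (h : a < b) {c : M.N} (hc : 0 < c) :
    a * c < b * c := by
  refine bdd_induction (P := fun c => 0 < c → a * c < b * c) inferInstance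
    (fun h => (N.not_lt_zero _ h).elim) (fun c ih _ => ?_) c hc
  have key : a * c + a < a * c + b := by
    rw [add_comm _ a, add_comm _ b]
    exact N.add_lt_add h _
  rw [N.mul_succ, N.mul_succ]
  rcases N.zero_lt_or c with h0 | rfl
  · exact key.trans (N.add_lt_add (ih h0) b)
  · simpa using h

instance : IsOrderedCancelAddMonoid M.N where
  add_le_add_left a b h c := by
    rcases h with h | rfl
    exacts [.inl (N.add_lt_add h c), le_rfl]
  le_of_add_le_add_left a b c h := by
    by_contra h'
    have := N.add_lt_add (not_le.1 h') a
    rw [add_comm c, add_comm b] at this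
    exact this.not_ge h

instance : IsStrictOrderedRing M.N where
  zero_le_one := N.zero_le 1
  exists_pair_ne := ⟨0, 1, fun h => by
    have := N.lt_succ (0 : M.N)
    rw [zero_add, ← h] at this
    exact lt_irrefl _ this⟩
  mul_lt_mul_of_pos_left c hc a b h := by
    rw [mul_comm c, mul_comm c]
    exact N.mul_lt_mul h hc
  mul_lt_mul_of_pos_right c hc a b h := N.mul_lt_mul h hc

end N

end Arithmetic

theorem Bdd.comp₁ {P : M.N → Prop} (hP : Bdd fun v : Fin 1 → M.N => P (v 0))
    (f : (Fin n → M.N) → M.N) [hf : IsTerm f] : Bdd fun v => P (f v) :=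
  Bdd.subst (P := fun v : Fin 1 → M.N => P (v 0)) (σ := fun v => ![f v]) fun i => by
    fin_cases i
    exact hf

theorem Bdd.comp₃ {P : M.N → M.N → M.N → Prop}
    (hP : Bdd fun v : Fin 3 → M.N => P (v 0) (v 1) (v 2))
    (f g h : (Fin n → M.N) → M.N) [hf : IsTerm f] [hg : IsTerm g] [hh : IsTerm h] :
    Bdd fun v => P (f v) (g v) (h v) :=
  Bdd.subst (P := fun v : Fin 3 → M.N => P (v 0) (v 1) (v 2))
    (σ := fun v => ![f v, g v, h v]) fun i => by
      fin_cases i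
      exacts [hf, hg, hh]

/-! ### Σ⁰₁ definability, comprehension, least and greatest elements -/

/-- `P` is definable by a `Σ⁰₁` formula with parameters. -/
class Sig (P : (Fin n → M.N) → Prop) : Prop where
  exists_bdd : ∃ Q : (Fin (n + 1) → M.N) → Prop, Bdd Q ∧ ∀ v, P v ↔ ∃ u, Q (Fin.cons u v)

namespace Sig

instance (priority := low) of_bdd {P : (Fin n → M.N) → Prop} [Bdd P] : Sig P :=
  ⟨fun w => P fun i => w i.succ, Bdd.subst fun i => IsTerm.var i.succ, fun v => by simp⟩

theorem subst {m : ℕ} {P : (Fin n → M.N) → Prop} {σ : (Fin m → M.N) → Fin n → M.N} [hP : Sig P]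
    (hσ : ∀ i, IsTerm fun v => σ v i) : Sig fun v => P (σ v) := by
  obtain ⟨Q, hQ, h⟩ := hP
  refine ⟨fun w => Q (Fin.cons (w 0) (σ fun i => w i.succ)), Bdd.subst fun i => ?_,
    fun v => by simp [h]⟩
  refine Fin.cases ?_ (fun j => ?_) i
  · exact IsTerm.var 0
  · obtain ⟨t, ht⟩ := hσ j
    exact ⟨t.subst fun i => .var i.succ, fun v => by simp [Term.val_subst, ht, Term.val]⟩

theorem comp₁ {P : M.N → Prop} (hP : Sig fun v : Fin 1 → M.N => P (v 0))
    (f : (Fin n → M.N) → M.N) [hf : IsTerm f] : Sig fun v => P (f v) :=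
  Sig.subst (P := fun v : Fin 1 → M.N => P (v 0)) (σ := fun v => ![f v]) fun i => by
    fin_cases i
    exact hf

theorem comp₃ {P : M.N → M.N → M.N → Prop}
    (hP : Sig fun v : Fin 3 → M.N => P (v 0) (v 1) (v 2))
    (f g h : (Fin n → M.N) → M.N) [hf : IsTerm f] [hg : IsTerm g] [hh : IsTerm h] :
    Sig fun v => P (f v) (g v) (h v) :=
  Sig.subst (P := fun v : Fin 3 → M.N => P (v 0) (v 1) (v 2))
    (σ := fun v => ![f v, g v, h v]) fun i => by
      fin_cases i
      exacts [hf, hg, hh]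

instance and_left {P Q : (Fin n → M.N) → Prop} [hP : Bdd P] [hQ : Sig Q] :
    Sig fun v => P v ∧ Q v := by
  obtain ⟨R, hR, h⟩ := hQ
  have : Bdd fun w : Fin (n + 1) → M.N => P fun i => w i.succ :=
    Bdd.subst fun i => IsTerm.var i.succ
  exact ⟨fun w => (P fun i => w i.succ) ∧ R w, inferInstance, fun v => by simp [h]⟩

end Sig

section Arithmetic

variable [hM : Fact M.IsModelRCA0]

instance Bdd.le {f g : (Fin n → M.N) → M.N} [IsTerm f] [IsTerm g] : Bdd fun v => f v ≤ g v :=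
  Bdd.congr (P := fun v => f v < g v + 1) fun _ => N.lt_add_one_iff

/-- With vacuous quantifiers in front, a bounded formula is both Σ⁰₁ and Π⁰₁. -/
theorem setOf_mem_sets {P : M.N → Prop} (hP : Bdd fun v : Fin 1 → M.N => P (v 0)) :
    {x | P x} ∈ M.sets := by
  obtain ⟨φ, hφ, h⟩ := Bdd.comp₁ hP fun w : Fin 2 → M.N => w 1
  have h1 : ∀ x, (Formula.ex φ).Holds x ↔ P x := fun x => by
    simp [Formula.Holds, Formula.Realize, h]
  have h2 : ∀ x, (Formula.all φ).Holds x ↔ P x := fun x => by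
    simp [Formula.Holds, Formula.Realize, h]
  obtain ⟨X, hX, hXP⟩ := hM.out.delta01_comprehension (.ex φ) (.all φ) ⟨φ, hφ, rfl⟩
    ⟨φ, hφ, rfl⟩ fun x => (h1 x).trans (h2 x).symm
  convert hX
  ext x
  exact ((hXP x).trans (h1 x)).symm

namespace Sig

/-- Two unbounded existential quantifiers merge into one: it guesses a common strict bound, below
which both witnesses are sought. -/
instance ex {P : (Fin n → M.N) → M.N → Prop}
    [hP : Sig fun w : Fin (n + 1) → M.N => P (fun i => w i.succ) (w 0)] :
    Sig fun v => ∃ x, P v x := by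
  obtain ⟨Q, hQ, h⟩ := hP
  have h' : ∀ v x, P v x ↔ ∃ u, Q (Fin.cons u (Fin.cons x v)) := fun v x => by
    simpa using h (Fin.cons x v)
  have : Bdd fun w : Fin (n + 3) → M.N =>
      Q (Fin.cons (w 0) (Fin.cons (w 1) fun i => w i.succ.succ.succ)) :=
    Bdd.subst fun i => by
      refine Fin.cases ?_ (fun j => Fin.cases ?_ (fun k => ?_) j) i
      exacts [IsTerm.var 0, IsTerm.var 1, IsTerm.var k.succ.succ.succ]
  refine ⟨fun w => ∃ x, x < w 0 ∧ ∃ u, u < w 0 ∧ Q (Fin.cons u (Fin.cons x fun i => w i.succ)),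
    ?_, fun v => ?_⟩
  · have h2 : Bdd fun w : Fin (n + 2) → M.N => ∃ u, u < w 1 ∧
        Q (Fin.cons u (Fin.cons (w 0) fun i => w i.succ.succ)) :=
      Bdd.exLT (P := fun w u => Q (Fin.cons u (Fin.cons (w 0) fun i => w i.succ.succ)))
        (hP := this)
    exact Bdd.exLT (P := fun w x => ∃ u, u < w 0 ∧ Q (Fin.cons u (Fin.cons x fun i => w i.succ)))
      (hP := h2)
  · simp only [h', Fin.cons_zero, Fin.cons_succ]
    constructor
    · rintro ⟨x, u, hxu⟩
      exact ⟨max x u + 1, x, N.lt_add_one_iff.2 (le_max_left _ _), u,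
        N.lt_add_one_iff.2 (le_max_right _ _), hxu⟩
    · rintro ⟨_, x, -, u, -, hxu⟩
      exact ⟨x, u, hxu⟩

theorem induction {P : M.N → Prop} (hP : Sig fun v : Fin 1 → M.N => P (v 0)) (h0 : P 0)
    (h1 : ∀ x, P x → P (x + 1)) (x : M.N) : P x := by
  obtain ⟨Q, ⟨φ, hφ, hQ⟩, h⟩ := hP
  have key : ∀ y, (Formula.ex φ).Holds y ↔ P y := fun y => by
    simpa [Formula.Holds, Formula.Realize, hQ] using (h ![y]).symm
  exact (key x).1 (hM.out.sigma01_induction (.ex φ) ⟨φ, hφ, rfl⟩ ((key 0).2 h0)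
    (fun y hy => (key _).2 (h1 y ((key y).1 hy))) x)

theorem exists_least {P : M.N → Prop} (hP : Sig fun v : Fin 1 → M.N => P (v 0)) {c : M.N}
    (hc : P c) : ∃ x, P x ∧ ∀ y, P y → x ≤ y := by
  by_contra! H
  have hP' := hP.comp₁ fun w : Fin 2 → M.N => w 0
  -- The induction formula must be Σ⁰₁, so it cannot say that P fails below x. Instead, x counts how
  -- often one can descend within P from c; c + 1 steps are too many.
  obtain ⟨y, hy, -⟩ := induction (P := fun x => ∃ y, y + x ≤ c ∧ P y) inferInstance
    ⟨c, (add_zero c).le, hc⟩ (fun x ⟨y, hy, hPy⟩ => by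
      obtain ⟨z, hz, hzy⟩ := H y hPy
      refine ⟨z, le_trans ?_ hy, hz⟩
      rw [← add_assoc, add_right_comm]
      exact add_le_add_left (N.add_one_le_iff.2 hzy) x) (c + 1)
  have : c + 1 ≤ c := (le_add_of_nonneg_left (N.zero_le y)).trans hy
  exact (N.add_one_le_iff.1 this).false

theorem exists_greatest {P : M.N → Prop} (hP : Sig fun v : Fin 1 → M.N => P (v 0)) {a c : M.N}
    (hc : P c) (ha : ∀ y, P y → y ≤ a) : ∃ x, P x ∧ ∀ y, P y → y ≤ x := by
  by_contra! H
  have hP' := hP.comp₁ fun w : Fin 2 → M.N => w 0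
  obtain ⟨y, hy, hPy⟩ := induction (P := fun x => ∃ y, x ≤ y ∧ P y) inferInstance
    ⟨c, N.zero_le c, hc⟩ (fun x ⟨y, hy, hPy⟩ => by
      obtain ⟨z, hz, hzy⟩ := H y hPy
      exact ⟨z, N.add_one_le_iff.2 (hy.trans_lt hzy), hz⟩) (a + 1)
  exact (N.add_one_le_iff.1 (hy.trans (ha y hPy))).false

end Sig

/-! ### The pairing function -/

namespace N

theorem eq_zero_or_succ (a : M.N) : a = 0 ∨ ∃ b, b < a ∧ a = b + 1 := by
  refine bdd_induction (P := fun a => a = 0 ∨ ∃ b, b < a ∧ a = b + 1) inferInstance (.inl rfl)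
    (fun a _ => .inr ⟨a, N.lt_succ a, rfl⟩) a

theorem le_mul_self (a : M.N) : a ≤ a * a := by
  rcases N.zero_lt_or a with h | rfl
  · refine le_mul_of_one_le_left (N.zero_le a) ?_
    simpa using add_one_le_iff.2 h
  · simp

/-- The pairs with sum n have codes from n² to n² + n, which lie below (n + 1)². -/
theorem pair_lt_pair {x y x' y' : M.N} (h : x + y < x' + y') : M.pair x y < M.pair x' y' := by
  unfold L2Structure.pair
  have h1 : x + y + 1 ≤ x' + y' := add_one_le_iff.2 h
  calc (x + y) * (x + y) + x < (x + y + 1) * (x + y + 1) := by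
        have : (x + y + 1) * (x + y + 1) = (x + y) * (x + y) + x + (x + y + y) + 1 := by ring
        rw [this, lt_add_one_iff]
        exact le_add_of_nonneg_right (N.zero_le _)
    _ ≤ (x' + y') * (x' + y') := mul_le_mul h1 h1 (N.zero_le _) (N.zero_le _)
    _ ≤ _ := le_add_of_nonneg_right (N.zero_le _)

theorem pair_inj {x y x' y' : M.N} : M.pair x y = M.pair x' y' ↔ x = x' ∧ y = y' := by
  refine ⟨fun h => ?_, fun ⟨h, h'⟩ => h ▸ h' ▸ rfl⟩
  rcases lt_trichotomy (x + y) (x' + y') with h' | h' | h'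
  · exact ((pair_lt_pair h').ne h).elim
  · unfold L2Structure.pair at h
    rw [h'] at h
    obtain rfl := add_left_cancel h
    exact ⟨rfl, add_left_cancel h'⟩
  · exact ((pair_lt_pair h').ne' h).elim

theorem left_le_pair (x y : M.N) : x ≤ M.pair x y := le_add_of_nonneg_left (N.zero_le _)

theorem right_le_pair (x y : M.N) : y ≤ M.pair x y :=
  calc y ≤ x + y := le_add_of_nonneg_left (N.zero_le _)
    _ ≤ (x + y) * (x + y) := le_mul_self _
    _ ≤ _ := le_add_of_nonneg_right (N.zero_le _)

end N

end Arithmetic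

/-- Wrapping membership in `M.sets` as a `Fact` lets instance search handle set parameters. -/
instance Bdd.mem_fact {f : (Fin n → M.N) → M.N} [IsTerm f] {X : Set M.N}
    [hX : Fact (X ∈ M.sets)] : Bdd fun v => f v ∈ X :=
  Bdd.mem hX.out

/-! ### Triples and their lexicographic order -/

/-- The code of a triple. -/
def code (z : M.N × M.N × M.N) : M.N :=
  M.pair z.1 (M.pair z.2.1 z.2.2)

/-- Triples are ordered lexicographically, with the order of the first component reversed. -/
def key (z : M.N × M.N × M.N) : M.Nᵒᵈ ×ₗ (M.N ×ₗ M.N) :=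
  toLex (OrderDual.toDual z.1, toLex (z.2.1, z.2.2))

theorem key_injective : Function.Injective (key (M := M)) := fun z w h => by
  simpa [key, Prod.ext_iff] using h

theorem key_lt_key {z w : M.N × M.N × M.N} : key z < key w ↔
    w.1 < z.1 ∨ z.1 = w.1 ∧ (z.2.1 < w.2.1 ∨ z.2.1 = w.2.1 ∧ z.2.2 < w.2.2) := by
  simp [key, Prod.Lex.toLex_lt_toLex]

section Arithmetic

variable [hM : Fact M.IsModelRCA0]

theorem code_inj {z w : M.N × M.N × M.N} : code z = code w ↔ z = w := by
  simp [code, N.pair_inj, Prod.ext_iff]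

theorem fst_le_code (z : M.N × M.N × M.N) : z.1 ≤ code z := N.left_le_pair _ _

theorem snd_fst_le_code (z : M.N × M.N × M.N) : z.2.1 ≤ code z :=
  (N.left_le_pair _ _).trans (N.right_le_pair _ _)

theorem snd_snd_le_code (z : M.N × M.N × M.N) : z.2.2 ≤ code z :=
  (N.right_le_pair _ _).trans (N.right_le_pair _ _)

theorem key_le_key {z w : M.N × M.N × M.N} : key z ≤ key w ↔
    w.1 < z.1 ∨ z.1 = w.1 ∧ (z.2.1 < w.2.1 ∨ z.2.1 = w.2.1 ∧ z.2.2 ≤ w.2.2) := by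
  simp [key, Prod.Lex.toLex_le_toLex]

/-- Take the greatest first component, which exists because of the bound a, then the least second
and the least third one. The class only has to be Σ⁰₁, and the choices need only Σ⁰₁-induction. -/
theorem exists_key_le {P : M.N × M.N × M.N → Prop}
    (hP : Sig fun v : Fin 3 → M.N => P (v 0, v 1, v 2)) {a : M.N} (ha : ∀ z, P z → z.1 ≤ a)
    {z : M.N × M.N × M.N} (hz : P z) : ∃ z, P z ∧ ∀ w, P w → key z ≤ key w := by
  -- As a local instance for every arity n, this serves under any number of quantifiers.
  have := fun n => @Sig.comp₃ M n (fun x i s => P (x, i, s)) hP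
  obtain ⟨x, ⟨i, s, h⟩, hx⟩ := Sig.exists_greatest (P := fun x => ∃ i s, P (x, i, s))
    inferInstance ⟨z.2.1, z.2.2, hz⟩ fun y ⟨i, s, h⟩ => ha _ h
  obtain ⟨i, ⟨s, h⟩, hi⟩ := Sig.exists_least (P := fun i => ∃ s, P (x, i, s))
    inferInstance ⟨s, h⟩
  obtain ⟨s, h, hs⟩ := Sig.exists_least (P := fun s => P (x, i, s)) inferInstance h
  refine ⟨(x, i, s), h, fun ⟨y, j, t⟩ hw => key_le_key.2 ?_⟩
  rcases (hx y ⟨j, t, hw⟩).lt_or_eq with h1 | rfl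
  · exact .inl h1
  rcases (hi j ⟨t, hw⟩).lt_or_eq with h2 | rfl
  · exact .inr ⟨rfl, .inl h2⟩
  · exact .inr ⟨rfl, .inr ⟨rfl, hs t hw⟩⟩

/-! ### The tails of `B` as a descending sequence of well orders -/

/-- The triples in `B` with middle component at least `k`. -/
def tail (B : M.N × M.N × M.N → Prop) (k : M.N) (z : M.N × M.N × M.N) : Prop :=
  k ≤ z.2.1 ∧ B z

/-- The sequence of the orders on the tails of `B`. -/
def tailSeq (B : M.N × M.N × M.N → Prop) : Set M.N :=
  {p | ∃ k z w, p = M.pair (M.pair (code z) (code w)) k ∧ tail B k z ∧ tail B k w ∧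
    key z ≤ key w}

variable {B : M.N × M.N × M.N → Prop}

theorem tailSeq_mem_sets (hB : Bdd fun v : Fin 3 → M.N => B (v 0, v 1, v 2)) :
    tailSeq B ∈ M.sets := by
  have := fun n => @Bdd.comp₃ M n (fun x i s => B (x, i, s)) hB
  -- All components are at most the code p, so the quantifiers can be bounded.
  convert setOf_mem_sets (P := fun p => ∃ k, k < p + 1 ∧ ∃ x, x < p + 1 ∧ ∃ i, i < p + 1 ∧
    ∃ s, s < p + 1 ∧ ∃ x', x' < p + 1 ∧ ∃ i', i' < p + 1 ∧ ∃ s', s' < p + 1 ∧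
    p = M.pair (M.pair (M.pair x (M.pair i s)) (M.pair x' (M.pair i' s'))) k ∧
    (k ≤ i ∧ B (x, i, s)) ∧ (k ≤ i' ∧ B (x', i', s')) ∧
    (x' < x ∨ x = x' ∧ (i < i' ∨ i = i' ∧ s ≤ s'))) inferInstance using 1
  ext p
  constructor
  · rintro ⟨k, z, w, rfl, hz, hw, h⟩
    have hz' : ∀ y, y ≤ code z → y < M.pair (M.pair (code z) (code w)) k + 1 := fun y hy =>
      N.lt_add_one_iff.2 (hy.trans ((N.left_le_pair _ _).trans (N.left_le_pair _ _)))
    have hw' : ∀ y, y ≤ code w → y < M.pair (M.pair (code z) (code w)) k + 1 := fun y hy =>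
      N.lt_add_one_iff.2 (hy.trans ((N.right_le_pair _ _).trans (N.left_le_pair _ _)))
    exact ⟨k, N.lt_add_one_iff.2 (N.right_le_pair _ _), z.1, hz' _ (fst_le_code z),
      z.2.1, hz' _ (snd_fst_le_code z), z.2.2, hz' _ (snd_snd_le_code z),
      w.1, hw' _ (fst_le_code w), w.2.1, hw' _ (snd_fst_le_code w), w.2.2,
      hw' _ (snd_snd_le_code w), rfl, hz, hw, key_le_key.1 h⟩
  · rintro ⟨k, -, x, -, i, -, s, -, x', -, i', -, s', -, hp, hz, hw, h⟩
    exact ⟨k, (x, i, s), (x', i', s'), hp, hz, hw, key_le_key.2 h⟩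

theorem mem_nth_tailSeq {k p : M.N} : p ∈ M.nth (tailSeq B) k ↔
    ∃ z w, p = M.pair (code z) (code w) ∧ tail B k z ∧ tail B k w ∧ key z ≤ key w := by
  constructor
  · rintro ⟨k', z, w, h, h'⟩
    obtain ⟨rfl, rfl⟩ := N.pair_inj.1 h
    exact ⟨z, w, rfl, h'⟩
  · rintro ⟨z, w, rfl, h⟩
    exact ⟨k, z, w, rfl, h⟩

theorem pair_code_mem_nth_tailSeq {k : M.N} {z w : M.N × M.N × M.N} :
    M.pair (code z) (code w) ∈ M.nth (tailSeq B) k ↔ tail B k z ∧ tail B k w ∧ key z ≤ key w := by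
  rw [mem_nth_tailSeq]
  constructor
  · rintro ⟨z', w', h, h'⟩
    obtain ⟨h1, h2⟩ := N.pair_inj.1 h
    obtain rfl := code_inj.1 h1
    obtain rfl := code_inj.1 h2
    exact h'
  · exact fun h => ⟨z, w, rfl, h⟩

theorem mem_field_nth_tailSeq {k y : M.N} :
    y ∈ M.field (M.nth (tailSeq B) k) ↔ ∃ z, y = code z ∧ tail B k z := by
  constructor
  · intro h
    obtain ⟨z, w, h, hz, -⟩ := mem_nth_tailSeq.1 h
    exact ⟨z, (N.pair_inj.1 h).1, hz⟩
  · rintro ⟨z, rfl, hz⟩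
    exact pair_code_mem_nth_tailSeq.2 ⟨hz, hz, le_rfl⟩

theorem isLinOrd_nth_tailSeq (k : M.N) : M.IsLinOrd (M.nth (tailSeq B) k) := by
  refine ⟨fun p hp => ?_, fun x y z hxy hyz => ?_, fun x y hxy hyx => ?_, fun x hx y hy => ?_⟩
  · obtain ⟨z, w, rfl, hz, hw, -⟩ := mem_nth_tailSeq.1 hp
    exact ⟨_, mem_field_nth_tailSeq.2 ⟨z, rfl, hz⟩, _, mem_field_nth_tailSeq.2 ⟨w, rfl, hw⟩, rfl⟩
  · obtain ⟨x, y, h, hx, hy, h1⟩ := mem_nth_tailSeq.1 hxy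
    obtain ⟨rfl, rfl⟩ := N.pair_inj.1 h
    obtain ⟨y', z, h', hy, hz, h2⟩ := mem_nth_tailSeq.1 hyz
    obtain ⟨h3, rfl⟩ := N.pair_inj.1 h'
    obtain rfl := code_inj.1 h3
    exact pair_code_mem_nth_tailSeq.2 ⟨hx, hz, h1.trans h2⟩
  · obtain ⟨x, y, h, hx, hy, h1⟩ := mem_nth_tailSeq.1 hxy
    obtain ⟨rfl, rfl⟩ := N.pair_inj.1 h
    rw [key_injective (h1.antisymm (pair_code_mem_nth_tailSeq.1 hyx).2.2)]
  · obtain ⟨z, rfl, hz⟩ := mem_field_nth_tailSeq.1 hx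
    obtain ⟨w, rfl, hw⟩ := mem_field_nth_tailSeq.1 hy
    rcases le_total (key z) (key w) with h | h
    · exact .inl (pair_code_mem_nth_tailSeq.2 ⟨hz, hw, h⟩)
    · exact .inr (pair_code_mem_nth_tailSeq.2 ⟨hw, hz, h⟩)

theorem isWellOrd_nth_tailSeq {a : M.N} (ha : ∀ z, B z → z.1 ≤ a) (k : M.N) :
    M.IsWellOrd (M.nth (tailSeq B) k) := by
  refine ⟨isLinOrd_nth_tailSeq k, ?_⟩
  rintro ⟨F, hF, ⟨hF1, hF2⟩, hdesc⟩
  have := Fact.mk hF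
  have hval : ∀ m y, M.pair m y ∈ F → ∃ z, y = code z ∧ tail B k z := fun m y h => by
    obtain ⟨x, -, y', hy', h⟩ := hF1 _ h
    obtain ⟨rfl, rfl⟩ := N.pair_inj.1 h
    exact mem_field_nth_tailSeq.1 hy'
  obtain ⟨y, hy, -⟩ := hF2 0 trivial
  obtain ⟨z, rfl, -⟩ := hval _ _ hy
  -- The range of the descending sequence is a Σ⁰₁ class; the successor of its least value would be
  -- smaller still.
  obtain ⟨z, ⟨m, hm⟩, hmin⟩ := exists_key_le (P := fun z => ∃ m, M.pair m (code z) ∈ F)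
    (by unfold code; infer_instance) (a := a) (fun z ⟨m, hm⟩ => by
      obtain ⟨w, h, hw⟩ := hval _ _ hm
      obtain rfl := code_inj.1 h
      exact ha _ hw.2) ⟨0, hy⟩
  obtain ⟨y, hy, -⟩ := hF2 (m + 1) trivial
  obtain ⟨w, rfl, -⟩ := hval _ _ hy
  obtain ⟨h, hne⟩ := hdesc m _ _ hm hy
  exact hne (congrArg code
    (key_injective ((pair_code_mem_nth_tailSeq.1 h).2.2.antisymm (hmin w ⟨_, hy⟩))))

theorem embeds_nth_tailSeq (hB : Bdd fun v : Fin 3 → M.N => B (v 0, v 1, v 2)) (k : M.N) :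
    M.Embeds (M.nth (tailSeq B) (k + 1)) (M.nth (tailSeq B) k) := by
  have := fun n => @Bdd.comp₃ M n (fun x i s => B (x, i, s)) hB
  have hmono : ∀ z, tail B (k + 1) z → tail B k z := fun z hz =>
    ⟨(N.lt_succ k).le.trans hz.1, hz.2⟩
  have hF : {p | ∃ z, p = M.pair (code z) (code z) ∧ tail B (k + 1) z} ∈ M.sets := by
    convert setOf_mem_sets (P := fun p => ∃ x, x < p + 1 ∧ ∃ i, i < p + 1 ∧ ∃ s, s < p + 1 ∧
      p = M.pair (M.pair x (M.pair i s)) (M.pair x (M.pair i s)) ∧ k + 1 ≤ i ∧ B (x, i, s))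
      inferInstance using 1
    ext p
    constructor
    · rintro ⟨z, rfl, hz⟩
      have hz' : ∀ y, y ≤ code z → y < M.pair (code z) (code z) + 1 := fun y hy =>
        N.lt_add_one_iff.2 (hy.trans (N.left_le_pair _ _))
      exact ⟨z.1, hz' _ (fst_le_code z), z.2.1, hz' _ (snd_fst_le_code z), z.2.2,
        hz' _ (snd_snd_le_code z), rfl, hz⟩
    · rintro ⟨x, -, i, -, s, -, hp, hz⟩
      exact ⟨(x, i, s), hp, hz⟩
  refine ⟨_, hF, ⟨?_, ?_⟩, ?_⟩
  · rintro p ⟨z, rfl, hz⟩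
    exact ⟨_, mem_field_nth_tailSeq.2 ⟨z, rfl, hz⟩, _,
      mem_field_nth_tailSeq.2 ⟨z, rfl, hmono z hz⟩, rfl⟩
  · intro x hx
    obtain ⟨z, rfl, hz⟩ := mem_field_nth_tailSeq.1 hx
    refine ⟨code z, ⟨z, rfl, hz⟩, ?_⟩
    rintro y ⟨w, h, -⟩
    obtain ⟨h1, h2⟩ := N.pair_inj.1 h
    rw [h2, h1]
  · rintro x x' y y' ⟨z, h, hz⟩ ⟨w, h', hw⟩
    obtain ⟨rfl, rfl⟩ := N.pair_inj.1 h
    obtain ⟨rfl, rfl⟩ := N.pair_inj.1 h'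
    simp only [pair_code_mem_nth_tailSeq, hz, hw, hmono, true_and]

/-! ### Embeddings between tails -/

/-- An embedding between tails of `B` cannot lower any element by a row or more, because
otherwise the composition with the shift by one row would have a least descending element. -/
theorem exists_key_shift_le (hanti : ∀ x i s, B (x, i + 1, s) → B (x, i, s))
    {a : M.N} (ha : ∀ z, B z → z.1 ≤ a) {k m : M.N} (hkm : k < m)
    (hE : M.Embeds (M.nth (tailSeq B) k) (M.nth (tailSeq B) m)) {z : M.N × M.N × M.N}
    (hz : tail B k z) : ∃ w, tail B m w ∧ key (z.1, z.2.1 + 1, z.2.2) ≤ key w := by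
  obtain ⟨F, hF, ⟨hF1, hF2⟩, hemb⟩ := hE
  have := Fact.mk hF
  have hval : ∀ x y, M.pair x y ∈ F →
      (∃ z, x = code z ∧ tail B k z) ∧ ∃ w, y = code w ∧ tail B m w := fun x y h => by
    obtain ⟨x', hx', y', hy', h⟩ := hF1 _ h
    obtain ⟨rfl, rfl⟩ := N.pair_inj.1 h
    exact ⟨mem_field_nth_tailSeq.1 hx', mem_field_nth_tailSeq.1 hy'⟩
  have hex : ∀ z, tail B k z → ∃ w, M.pair (code z) (code w) ∈ F ∧ tail B m w := fun z hz => by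
    obtain ⟨y, hy, -⟩ := hF2 _ (mem_field_nth_tailSeq.2 ⟨z, rfl, hz⟩)
    obtain ⟨w, rfl, hw⟩ := (hval _ _ hy).2
    exact ⟨w, hy, hw⟩
  have hmem : ∀ z w, M.pair (code z) (code w) ∈ F → tail B k z ∧ tail B m w := fun z w h => by
    obtain ⟨⟨z', h1, hz'⟩, w', h2, hw'⟩ := hval _ _ h
    obtain rfl := code_inj.1 h1
    obtain rfl := code_inj.1 h2
    exact ⟨hz', hw'⟩
  by_contra! H
  obtain ⟨w, hzw, hw⟩ := hex z hz
  -- Choose the least z whose image w lies strictly below z moved up by one row.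
  obtain ⟨z, ⟨w, hzw, hlt⟩, hmin⟩ := exists_key_le
    (P := fun z => ∃ w, M.pair (code z) (code w) ∈ F ∧ key w < key (z.1, z.2.1 + 1, z.2.2))
    (by
      simp only [key_lt_key, code, Prod.exists]
      infer_instance)
    (a := a) (fun z ⟨w, hzw, _⟩ => ha _ (hmem _ _ hzw).1.2) ⟨w, hzw, H w hw⟩
  obtain ⟨x, i, s⟩ := w
  obtain ⟨hz, hmi, hw⟩ := hmem _ _ hzw
  -- The row index of w is at least m > k, so w can be moved down by one row and still lies in the
  -- tail from k.
  obtain rfl | ⟨i, -, rfl⟩ := N.eq_zero_or_succ i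
  · exact N.not_lt_zero _ (hkm.trans_le hmi)
  have hki : k ≤ i := N.lt_add_one_iff.1 (hkm.trans_le hmi)
  have hw' : tail B k (x, i, s) := ⟨hki, hanti _ _ _ hw⟩
  have hlt' : key (x, i, s) < key z := by
    rw [key_lt_key] at hlt ⊢
    simpa using hlt
  obtain ⟨y, hy, hym⟩ := hex _ hw'
  refine (hmin (x, i, s) ⟨y, hy, ?_⟩).not_gt hlt'
  -- The lowered point lies below z, so its image y lies below w, which is that point moved up by
  -- one row. So the lowered point is a smaller counterexample.
  have h1 := hemb _ _ _ _ hzw hy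
  rw [pair_code_mem_nth_tailSeq, pair_code_mem_nth_tailSeq] at h1
  by_contra h2
  exact hlt'.not_ge (h1.2 ⟨⟨hmi, hw⟩, hym, not_lt.1 h2⟩).2.2

/-- The element z lies in the last row of the tail from k, so nothing in that tail, let alone in the
tail from m, reaches z moved up by one row. -/
theorem not_embeds_nth_tailSeq (hanti : ∀ x i s, B (x, i + 1, s) → B (x, i, s))
    {a : M.N} (ha : ∀ z, B z → z.1 ≤ a) {k m : M.N} (hkm : k < m) {z : M.N × M.N × M.N}
    (hz : tail B k z) (hz1 : ∀ w, tail B k w → z.1 ≤ w.1)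
    (hz2 : ∀ w, tail B k w → w.1 = z.1 → w.2.1 ≤ z.2.1) :
    ¬ M.Embeds (M.nth (tailSeq B) k) (M.nth (tailSeq B) m) := fun hE => by
  obtain ⟨w, hw, h⟩ := exists_key_shift_le hanti ha hkm hE hz
  have hw' : tail B k w := ⟨hkm.le.trans hw.1, hw.2⟩
  refine h.not_gt (key_lt_key.2 ?_)
  rcases (hz1 w hw').lt_or_eq with h1 | h1
  · exact .inl h1
  · exact .inr ⟨h1.symm, .inl (N.lt_add_one_iff.2 (hz2 w hw' h1.symm))⟩

/-! ### From WF1 to Σ⁰₂-induction -/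

/-- A collection principle: the bound is enlarged for one u at a time. The existence of a bound is
Σ⁰₁, so Σ⁰₁-induction suffices. -/
theorem exists_bound {R : M.N → M.N → M.N → Prop}
    (hR : Bdd fun v : Fin 3 → M.N => R (v 0) (v 1) (v 2)) {x i : M.N}
    (h : ∀ u, u < i + 1 → ∃ v, ¬ R x u v) : ∃ s, ∀ u, u < i + 1 → ∃ v, v < s ∧ ¬ R x u v := by
  have := fun n => @Bdd.comp₃ M n _ hR
  obtain ⟨s, hs⟩ := Sig.induction
    -- The guard `u < i + 1` lets the induction run through all j: beyond i the old bound still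
    -- works.
    (P := fun j => ∃ s, ∀ u, u < j → u < i + 1 → ∃ v, v < s ∧ ¬ R x u v) inferInstance
    ⟨0, fun u hu => (N.not_lt_zero u hu).elim⟩ (fun j ⟨s, hs⟩ => by
      by_cases hj : j < i + 1
      · obtain ⟨v, hv⟩ := h j hj
        refine ⟨max s (v + 1), fun u hu hui => ?_⟩
        rcases N.lt_succ_iff.1 hu with hu | rfl
        · obtain ⟨v', hv', hR'⟩ := hs u hu hui
          exact ⟨v', hv'.trans_le (le_max_left _ _), hR'⟩
        · exact ⟨v, (N.lt_succ v).trans_le (le_max_right _ _), hv⟩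
      · refine ⟨s, fun u hu hui => hs u ?_ hui⟩
        exact hui.trans_le (not_lt.1 hj)) (i + 1)
  exact ⟨s, fun u hu => hs u hu hu⟩

theorem WF1.sigma02 (hWF1 : M.WF1) {R : M.N → M.N → M.N → Prop}
    (hR : Bdd fun v : Fin 3 → M.N => R (v 0) (v 1) (v 2)) (h0 : ∃ u, ∀ v, R 0 u v)
    (h1 : ∀ x, (∃ u, ∀ v, R x u v) → ∃ u, ∀ v, R (x + 1) u v) (a : M.N) :
    ∃ u, ∀ v, R a u v := by
  by_contra! H
  have := fun n => @Bdd.comp₃ M n _ hR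
  let B : M.N × M.N × M.N → Prop := fun z =>
    z.1 ≤ a ∧ ∀ u, u < z.2.1 + 1 → ∃ v, v < z.2.2 ∧ ¬ R z.1 u v
  have hB : Bdd fun v : Fin 3 → M.N => B (v 0, v 1, v 2) := by
    simp only [B]
    infer_instance
  have hBle : ∀ x i j s, i ≤ j → B (x, j, s) → B (x, i, s) := fun x i j s hij h =>
    ⟨h.1, fun u hu => h.2 u (hu.trans_le (add_le_add_left hij 1))⟩
  have ha : ∀ z, B z → z.1 ≤ a := fun z hz => hz.1
  obtain ⟨k, m, hkm, hE⟩ := hWF1 _ (tailSeq_mem_sets hB) (isWellOrd_nth_tailSeq ha)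
    (embeds_nth_tailSeq hB)
  have := fun n => @Bdd.comp₃ M n (fun x i s => B (x, i, s)) hB
  -- Reversing the first component puts the least x with a nonempty row k at the end of the order.
  -- The failure of ψ(a) shows that a is a candidate.
  obtain ⟨x, ⟨s, hs⟩, hx⟩ := Sig.exists_least (P := fun x => ∃ s, B (x, k, s)) inferInstance
    ((exists_bound hR fun u _ => H u).imp fun s hs => ⟨le_refl a, hs⟩)
  -- A predecessor y of x satisfies ψ: otherwise row (y, k) would be nonempty, against the
  -- minimality of x.
  have hψ : ∃ u, ∀ v, R x u v := by
    obtain rfl | ⟨y, hy, rfl⟩ := N.eq_zero_or_succ x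
    · exact h0
    · refine h1 y ?_
      by_contra! hy'
      obtain ⟨s', hs'⟩ := exists_bound hR (x := y) (i := k) fun u _ => hy' u
      exact (hx y ⟨s', hy.le.trans hs.1, hs'⟩).not_gt hy
  obtain ⟨u, hu⟩ := hψ
  -- A row (x, j) with j ≥ u is empty, as u has no counterexample. So a last row exists.
  obtain ⟨i, ⟨s, hs⟩, hi⟩ := Sig.exists_greatest (P := fun i => ∃ s, B (x, k, s) ∧ B (x, i, s))
    inferInstance ⟨s, hs, hs⟩ (a := u) fun j ⟨s, _, hj⟩ => by
      by_contra hju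
      obtain ⟨v, -, hv⟩ := hj.2 u (N.lt_add_one_iff.2 (not_le.1 hju).le)
      exact hv (hu v)
  refine not_embeds_nth_tailSeq (fun x i s => hBle x i _ s (N.lt_succ i).le) ha hkm
    (z := (x, i, s)) ⟨hi k ⟨s, hs.1, hs.1⟩, hs.2⟩ ?_ ?_ hE
  · rintro ⟨y, j, t⟩ ⟨hkj, hw⟩
    exact hx y ⟨t, hBle _ _ _ _ hkj hw⟩
  · rintro ⟨y, j, t⟩ ⟨hkj, hw⟩ rfl
    exact hi j ⟨t, hBle _ _ _ _ hkj hw, hw⟩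

end Arithmetic

end L2Structure

theorem mainTheorem5 (M : L2Structure.{u}) (hM : M.IsModelRCA0) (hWF1 : M.WF1) :
    M.Sigma02Induction := by
  rintro _ ⟨_, ⟨θ, hθ, rfl⟩, rfl⟩ h0 h1 x
  have := Fact.mk hM
  have hθ' : L2Structure.Bdd fun v : Fin 3 → M.N => θ.Realize v := ⟨θ, hθ, fun _ => Iff.rfl⟩
  refine hWF1.sigma02 (R := fun x u v => θ.Realize (Fin.cons v (Fin.cons u ![x]))) ?_ h0 h1 x
  -- Each quantifier binds variable 0, so θ reads its variables in the order v, u, x.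
  refine L2Structure.Bdd.subst (P := fun v : Fin 3 → M.N => θ.Realize v)
    (σ := fun v => Fin.cons (v 2) (Fin.cons (v 1) ![v 0])) fun i => ?_
  fin_cases i
  exacts [.var 2, .var 1, .var 0]
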